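/- Let $n$ be a natural number, let $H \le \mathrm{SL}(n,\mathbb{Z})$, and for a prime $p$ let $\varphi_p : \mathrm{SL}(n,\mathbb{Z}) \to \mathrm{SL}(n,p)$ be reduction modulo $p$. A subgroup $G$ of $\mathrm{GL}(n,\mathbb{F})$, $\mathbb{F}$ a field, is called monomial if it is conjugate in $\mathrm{GL}(n,\mathbb{F})$ to a group of monomial matrices (matrices with exactly one nonzero entry in each row and each column), and primitive if it acts irreducibly on $\mathbb{F}^n$ and there is no decomposition of $\mathbb{F}^n$ as a direct sum of $k \ge 2$ nonzero subspaces that are permuted by $G$. Subgroups of $\mathrm{SL}(n,\mathbb{Z})$ are regarded as linear groups over $\mathbb{Q}$, and $\varphi_p(H)$ as a linear group over the field with $p$ elements. A group is solvable-by-finite if it has a solvable normal subgroup of finite index. (i) If $H$ is not solvable-by-finite, then $\varphi_p(H)$ is not monomial for all but finitely many primes $p$ (that is, $\varphi_p(H)$ is monomial for only finitely many primes $p$). (ii) If $n$ is prime and $H$ is infinite, non-solvable, and primitive, then $\varphi_p(H)$ is primitive for all but finitely many primes $p$. -/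

import Mathlib

open Matrix

/-- A group is solvable-by-finite if it has a solvable normal subgroup of finite index. -/
def IsSolvableByFinite (G : Type*) [Group G] : Prop :=
  ∃ N : Subgroup G, N.Normal ∧ Group.IsSolvable N ∧ N.FiniteIndex

/-- The natural representation of a linear group `G ≤ GL(n, F)` on column vectors. -/
noncomputable def naturalRep {n : ℕ} {F : Type*} [Field F] (G : Subgroup (GL (Fin n) F)) :
    Representation F G (Fin n → F) :=
  ((Matrix.toLinAlgEquiv' : Matrix (Fin n) (Fin n) F ≃ₐ[F] ((Fin n → F) →ₗ[F] (Fin n → F)))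
      : Matrix (Fin n) (Fin n) F →* ((Fin n → F) →ₗ[F] (Fin n → F))).comp
    ((Units.coeHom (Matrix (Fin n) (Fin n) F)).comp G.subtype)

/-- A system of imprimitivity of `G ≤ GL(n, F)`: a decomposition of `F ^ n` as a direct sum of
`k ≥ 2` nonzero subspaces that are permuted by `G`. -/
structure IsSystemOfImprimitivity {n : ℕ} {F : Type*} [Field F] (G : Subgroup (GL (Fin n) F))
    {k : ℕ} (V : Fin k → Submodule F (Fin n → F)) : Prop where
  two_le : 2 ≤ k
  ne_bot : ∀ i, V i ≠ ⊥
  isInternal : DirectSum.IsInternal V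
  permuted : ∀ (g : G) (i : Fin k), ∃ j : Fin k, (V i).map (naturalRep G g) = V j

/-- A linear group over the field `F` is primitive if it is irreducible over `F` and has no system
of imprimitivity over `F`. -/
def IsPrimitiveLinearGroup {n : ℕ} {F : Type*} [Field F] (G : Subgroup (GL (Fin n) F)) : Prop :=
  (naturalRep G).IsIrreducible ∧
    ¬ ∃ (k : ℕ) (V : Fin k → Submodule F (Fin n → F)), IsSystemOfImprimitivity G V

/-- A monomial matrix: exactly one nonzero entry in each row and in each column. -/
def IsMonomialMatrix {n : ℕ} {F : Type*} [Field F] (A : Matrix (Fin n) (Fin n) F) : Prop :=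
  (∀ i, ∃! j, A i j ≠ 0) ∧ (∀ j, ∃! i, A i j ≠ 0)

/-- A linear group over the field `F` is monomial if it is conjugate in `GL(n, F)` to a group of
monomial matrices. -/
def IsMonomialLinearGroup {n : ℕ} {F : Type*} [Field F] (G : Subgroup (GL (Fin n) F)) : Prop :=
  ∃ x : GL (Fin n) F, ∀ g ∈ G,
    IsMonomialMatrix ((x⁻¹ * g * x : GL (Fin n) F) : Matrix (Fin n) (Fin n) F)

/-- `H ≤ SL(n, ℤ)` regarded as a subgroup of `GL(n, ℚ)`. -/
def overRat {n : ℕ} (H : Subgroup (SpecialLinearGroup (Fin n) ℤ)) : Subgroup (GL (Fin n) ℚ) :=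
  (H.map (SpecialLinearGroup.map (Int.castRingHom ℚ))).map SpecialLinearGroup.toGL

/-- The congruence image `φ_p(H) ≤ SL(n, p)` of `H ≤ SL(n, ℤ)`, entrywise reduction modulo the
prime `p`, regarded as a subgroup of `GL(n, p)`. -/
def congruenceImage {n : ℕ} (p : ℕ) (H : Subgroup (SpecialLinearGroup (Fin n) ℤ)) :
    Subgroup (GL (Fin n) (ZMod p)) :=
  (H.map (SpecialLinearGroup.map (Int.castRingHom (ZMod p)))).map SpecialLinearGroup.toGL

/-! Suppose `congruenceImage p H` is monomial for infinitely many `p`. Each such `p` gives an action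
of `H` on `Fin n`, and elements acting trivially commute modulo `p`. A nonprincipal ultrafilter on
these primes yields a limit action, whose kernel `K` has finite index. Two elements of `K` commute
modulo infinitely many primes, hence over ℤ. So `H` is abelian-by-finite, which gives (i). For (ii),
`H` is irreducible and nonabelian, so by Burnside's theorem in prime degree it spans all rational
matrices, and its images are irreducible for almost all `p`. An irreducible imprimitive group of
prime degree has one-dimensional blocks, so it is monomial. If this happened for infinitely many
`p`, then `K` as above would be infinite, hence nonscalar. By primitivity `K` generates a field `E`
of degree `n`; it is its own centralizer and `H` modulo that centralizer embeds in Aut(E/ℚ), of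
order 1 or `n`. Then `H` would be solvable (`isSolvable_of_primitive_of_abelian_normal`). -/

/-! ### Monomial matrices and their permutations -/

namespace IsMonomialMatrix

variable {n : ℕ} {F : Type*} [Field F] {A B : Matrix (Fin n) (Fin n) F}

/-- The row of the nonzero entry in each column of a monomial matrix. -/
noncomputable def perm (hA : IsMonomialMatrix A) (j : Fin n) : Fin n :=
  (hA.2 j).choose

theorem ne_zero_iff (hA : IsMonomialMatrix A) {i j : Fin n} : A i j ≠ 0 ↔ i = hA.perm j :=
  ⟨fun h => (hA.2 j).choose_spec.2 i h, fun h => h ▸ (hA.2 j).choose_spec.1⟩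

theorem perm_mul (hA : IsMonomialMatrix A) (hB : IsMonomialMatrix B)
    (hAB : IsMonomialMatrix (A * B)) : hAB.perm = hA.perm ∘ hB.perm := by
  funext j
  have h : (A * B) (hA.perm (hB.perm j)) j ≠ 0 := by
    rw [Matrix.mul_apply, Finset.sum_eq_single (hB.perm j)]
    · exact mul_ne_zero (hA.ne_zero_iff.2 rfl) (hB.ne_zero_iff.2 rfl)
    · intro k _ hk
      rw [not_ne_iff.1 (mt hB.ne_zero_iff.1 hk), mul_zero]
    · simp
  exact (hAB.ne_zero_iff.1 h).symm

theorem perm_one (h : IsMonomialMatrix (1 : Matrix (Fin n) (Fin n) F)) : h.perm = id := by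
  funext j
  exact (h.ne_zero_iff.1 (by rw [id, Matrix.one_apply_eq]; exact one_ne_zero)).symm

theorem eq_diagonal (hA : IsMonomialMatrix A) (h : hA.perm = id) :
    A = Matrix.diagonal fun i => A i i := by
  ext i j
  by_cases hij : i = j
  · simp [hij]
  · rw [Matrix.diagonal_apply_ne _ hij]
    by_contra hne
    exact hij (by simpa [h] using hA.ne_zero_iff.1 hne)

end IsMonomialMatrix

/-- The permutation action of a group of matrices which are monomial after conjugation. -/
noncomputable def monomialPerm {n : ℕ} {F G : Type*} [Field F] [Group G] (f : G →* GL (Fin n) F)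
    (x : GL (Fin n) F)
    (h : ∀ g, IsMonomialMatrix ((x⁻¹ * f g * x : GL (Fin n) F) : Matrix (Fin n) (Fin n) F)) :
    G →* Function.End (Fin n) where
  toFun g := (h g).perm
  map_one' := by
    have h1 : IsMonomialMatrix (1 : Matrix (Fin n) (Fin n) F) := by simpa using h 1
    have : ∀ (A : Matrix (Fin n) (Fin n) F) (hA : IsMonomialMatrix A), A = 1 → hA.perm = id := by
      rintro _ hA rfl
      exact hA.perm_one
    exact this _ _ (by simp)
  map_mul' a b := by
    have : ∀ (A B C : Matrix (Fin n) (Fin n) F) (hA : IsMonomialMatrix A)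
        (hB : IsMonomialMatrix B) (hC : IsMonomialMatrix C), C = A * B →
        hC.perm = hA.perm ∘ hB.perm := by
      rintro A B _ hA hB hC rfl
      exact hA.perm_mul hB hC
    refine this _ _ _ _ _ _ ?_
    rw [← Units.val_mul, map_mul]
    congr 1
    group

/-- Conjugation by the one matrix `x` makes both images diagonal. -/
theorem commute_of_monomialPerm_eq_one {n : ℕ} {F G : Type*} [Field F] [Group G]
    (f : G →* GL (Fin n) F) (x : GL (Fin n) F)
    (h : ∀ g, IsMonomialMatrix ((x⁻¹ * f g * x : GL (Fin n) F) : Matrix (Fin n) (Fin n) F))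
    {a b : G} (ha : monomialPerm f x h a = 1) (hb : monomialPerm f x h b = 1) :
    f a * f b = f b * f a := by
  have hc : (x⁻¹ * f a * x) * (x⁻¹ * f b * x) = (x⁻¹ * f b * x) * (x⁻¹ * f a * x) := by
    ext1
    rw [Units.val_mul (x⁻¹ * f a * x), Units.val_mul (x⁻¹ * f b * x), (h a).eq_diagonal ha, (h b).eq_diagonal hb,
      Matrix.diagonal_mul_diagonal, Matrix.diagonal_mul_diagonal]
    simp only [mul_comm]
  calc f a * f b = x * ((x⁻¹ * f a * x) * (x⁻¹ * f b * x)) * x⁻¹ := by group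
    _ = x * ((x⁻¹ * f b * x) * (x⁻¹ * f a * x)) * x⁻¹ := by rw [hc]
    _ = f b * f a := by group

/-! ### Ultrafilter limits and reduction modulo infinitely many primes -/

/-- Homomorphisms into a finite monoid have a limit along an ultrafilter. -/
theorem Ultrafilter.exists_monoidHom_eventually_eq {α G M : Type*} [Monoid G] [Monoid M] [Finite M]
    (u : Ultrafilter α) (f : α → G →* M) :
    ∃ φ : G →* M, ∀ g, ∀ᶠ a in u, f a g = φ g := by
  have h : ∀ g, ∃ m, ∀ᶠ a in u, f a g = m := fun g =>
    Ultrafilter.eventually_exists_iff.1 (.of_forall fun a => ⟨f a g, rfl⟩)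
  choose φ hφ using h
  refine ⟨⟨⟨φ, ?_⟩, ?_⟩, hφ⟩
  · obtain ⟨a, ha⟩ := (hφ 1).exists
    rw [← ha, map_one]
  · intro x y
    obtain ⟨a, ⟨hx, hy⟩, hxy⟩ := (((hφ x).and (hφ y)).and (hφ (x * y))).exists
    change φ (x * y) = φ x * φ y
    rw [← hx, ← hy, ← hxy, map_mul]

/-- Entrywise reduction `SL(n, ℤ) → GL(n, F)`. -/
def slToGL (n : ℕ) (F : Type*) [Field F] : SpecialLinearGroup (Fin n) ℤ →* GL (Fin n) F :=
  SpecialLinearGroup.toGL.comp (SpecialLinearGroup.map (Int.castRingHom F))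

theorem congruenceImage_eq_map {n : ℕ} (p : ℕ) [Fact p.Prime]
    (H : Subgroup (SpecialLinearGroup (Fin n) ℤ)) :
    congruenceImage p H = H.map (slToGL n (ZMod p)) :=
  Subgroup.map_map _ _ _

theorem overRat_eq_map {n : ℕ} (H : Subgroup (SpecialLinearGroup (Fin n) ℤ)) :
    overRat H = H.map (slToGL n ℚ) :=
  Subgroup.map_map _ _ _

/-- Distinct integer matrices are congruent modulo finitely many primes only. -/
theorem finite_setOf_slToGL_eq {n : ℕ} {c d : SpecialLinearGroup (Fin n) ℤ} (h : c ≠ d) :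
    {p : ℕ | ∃ _ : Fact p.Prime, slToGL n (ZMod p) c = slToGL n (ZMod p) d}.Finite := by
  have : ∃ i j, c i j ≠ d i j := by
    by_contra! hcd
    exact h (Matrix.SpecialLinearGroup.ext _ _ hcd)
  obtain ⟨i, j, hne⟩ := this
  refine (Finset.finite_toSet (c i j - d i j).natAbs.primeFactors).subset ?_
  rintro p ⟨hp, hpe⟩
  have hz : ((c i j : ℤ) : ZMod p) = (d i j : ℤ) :=
    congrArg (fun A : GL (Fin n) (ZMod p) => (A : Matrix (Fin n) (Fin n) (ZMod p)) i j) hpe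
  rw [Finset.mem_coe, Nat.mem_primeFactors]
  refine ⟨hp.out, Int.natCast_dvd.1 ?_, Int.natAbs_ne_zero.2 (sub_ne_zero.2 hne)⟩
  rw [← ZMod.intCast_zmod_eq_zero_iff_dvd, Int.cast_sub, hz, sub_self]

/-- If infinitely many congruence images of `H` are monomial, then `H` is abelian-by-finite. -/
theorem exists_abelian_finiteIndex_of_infinite_monomial {n : ℕ}
    {H : Subgroup (SpecialLinearGroup (Fin n) ℤ)}
    (hinf : {p : ℕ | ∃ _ : Fact p.Prime,
      IsMonomialLinearGroup (congruenceImage p H)}.Infinite) :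
    ∃ K : Subgroup H, K.Normal ∧ K.FiniteIndex ∧ ∀ a ∈ K, ∀ b ∈ K, a * b = b * a := by
  set S := {p : ℕ | ∃ _ : Fact p.Prime, IsMonomialLinearGroup (congruenceImage p H)} with hS
  have : Infinite S := hinf.to_subtype
  have hp : ∀ p : S, Fact (p : ℕ).Prime := fun p => p.2.1
  have hmon : ∀ p : S, ∃ x : GL (Fin n) (ZMod p), ∀ g : H, IsMonomialMatrix
      ((x⁻¹ * (slToGL n (ZMod p)).comp H.subtype g * x : GL (Fin n) (ZMod p)) :
        Matrix (Fin n) (Fin n) (ZMod p)) := by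
    intro p
    obtain ⟨_, x, hx⟩ := p.2
    refine ⟨x, fun g => hx _ ?_⟩
    rw [congruenceImage_eq_map]
    exact ⟨g, g.2, rfl⟩
  choose x hx using hmon
  let u : Ultrafilter S := Filter.hyperfilter S
  have : Finite (Function.End (Fin n)) := inferInstanceAs (Finite (Fin n → Fin n))
  obtain ⟨φ, hφ⟩ := u.exists_monoidHom_eventually_eq
    fun p : S => monomialPerm ((slToGL n (ZMod p)).comp H.subtype) (x p) (hx p)
  -- `φ` maps into a monoid; as a map to its finite group of units, it has a kernel of finite index.
  refine ⟨φ.toHomUnits.ker, inferInstance, inferInstance, fun a ha b hb => ?_⟩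
  have hker : ∀ c ∈ φ.toHomUnits.ker, φ c = 1 := fun c hc => congrArg Units.val hc
  have hev : ∀ᶠ p : S in u, slToGL n (ZMod p) (a * b : H) = slToGL n (ZMod p) (b * a : H) := by
    filter_upwards [hφ a, hφ b] with p h1 h2
    have := commute_of_monomialPerm_eq_one _ _ (hx p) (h1.trans (hker a ha))
      (h2.trans (hker b hb))
    simpa using this
  -- The hyperfilter contains no finite set.
  have hinf' : {p : S | slToGL n (ZMod p) (a * b : H) = slToGL n (ZMod p) (b * a : H)}.Infinite :=
    fun hfin => Filter.notMem_hyperfilter_of_finite hfin hev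
  refine Subtype.ext (by_contra fun hne => hinf' ?_)
  refine Set.Finite.of_finite_image ((finite_setOf_slToGL_eq hne).subset ?_)
    Subtype.val_injective.injOn
  rintro _ ⟨p, hpe, rfl⟩
  exact ⟨hp p, hpe⟩

/-! ### Subfields of End(V) and Burnside's theorem in prime dimension -/

section EndomorphismAlgebra

open Module

universe u

variable {k : Type*} {V : Type u} [Field k] [AddCommGroup V] [Module k V]

/-- Multiplication by a nonzero element is an injective linear map of a finite-dimensional space,
hence surjective. -/
theorem Subalgebra.isField_of_mul_eq_zero [FiniteDimensional k V] [Nontrivial V]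
    (F : Subalgebra k (End k V))
    (hcomm : ∀ x ∈ F, ∀ y ∈ F, x * y = y * x)
    (hzero : ∀ x ∈ F, ∀ y ∈ F, x ≠ 0 → x * y = 0 → y = 0) : IsField F where
  exists_pair_ne := ⟨0, 1, zero_ne_one⟩
  mul_comm x y := Subtype.ext (hcomm x x.2 y y.2)
  mul_inv_cancel {x} hx := by
    have hinj : Function.Injective (LinearMap.mulLeft k x) := by
      rw [injective_iff_map_eq_zero]
      intro y hy
      exact Subtype.ext (hzero x x.2 y y.2 (fun h => hx (Subtype.ext h)) (congrArg Subtype.val hy))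
    exact LinearMap.injective_iff_surjective.1 hinj 1

/-- `V` is a vector space over `F`, so the tower law applies. -/
theorem Subalgebra.finrank_dvd_of_isField [FiniteDimensional k V] (F : Subalgebra k (End k V))
    (hF : IsField F) : finrank k F ∣ finrank k V := by
  let := hF.toField
  have := Module.finrank_mul_finrank k F V
  exact ⟨_, this.symm⟩

theorem Subalgebra.finrank_eq_of_isField_of_ne_bot [FiniteDimensional k V]
    (hV : (finrank k V).Prime) (F : Subalgebra k (End k V)) (hF : IsField F) (hne : F ≠ ⊥) :
    finrank k F = finrank k V := by
  have : Nontrivial V := nontrivial_of_finrank_pos hV.pos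
  exact (hV.eq_one_or_self_of_dvd _ (F.finrank_dvd_of_isField hF)).resolve_left
    fun h => hne (Subalgebra.finrank_eq_one_iff.1 h)

/-- The centralizer of a maximal subfield of dimension `dim V` is commutative. -/
theorem Subalgebra.mul_comm_of_commute_isField [FiniteDimensional k V] [Nontrivial V]
    {F : Subalgebra k (End k V)} (hF : IsField F) (hdim : finrank k F = finrank k V)
    {a b : End k V} (ha : ∀ f ∈ F, a * f = f * a) (hb : ∀ f ∈ F, b * f = f * b) :
    a * b = b * a := by
  obtain ⟨v, hv⟩ := exists_ne (0 : V)
  -- Evaluation at `v` identifies `F` with `V`, so an endomorphism commuting with `F` is determined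
  -- by its value at `v` and lies in `F`.
  let e : F →ₗ[k] V := (LinearMap.applyₗ v).comp F.val.toLinearMap
  have he : ∀ f : F, e f = (f : End k V) v := fun _ => rfl
  have hinj : Function.Injective e := by
    rw [injective_iff_map_eq_zero]
    intro f hf
    by_contra hne
    obtain ⟨g, hg⟩ := hF.mul_inv_cancel hne
    rw [hF.mul_comm] at hg
    have : ((g * f : F) : End k V) v = 0 := by
      rw [Subalgebra.coe_mul, Module.End.mul_apply, ← he, hf, map_zero]
    rw [hg] at this
    exact hv this
  have hsurj : Function.Surjective e :=
    (LinearMap.injective_iff_surjective_of_finrank_eq_finrank hdim).1 hinj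
  obtain ⟨f, hf⟩ := hsurj (a v)
  obtain ⟨g, hg⟩ := hsurj (b v)
  rw [he] at hf hg
  have key : ∀ (c : End k V) (q : F), (∀ f ∈ F, c * f = f * c) → (q : End k V) v = c v →
      c = q := by
    intro c q hc hq
    ext w
    obtain ⟨h, rfl⟩ := hsurj w
    have h1 := LinearMap.congr_fun (hc h h.2) v
    have h2 := LinearMap.congr_fun (congrArg Subtype.val (hF.mul_comm q h)) v
    simp only [Subalgebra.coe_mul, Module.End.mul_apply] at h1 h2
    rw [he, h1, h2, hq]
  rw [key a f ha hf, key b g hb hg]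
  exact congrArg Subtype.val (hF.mul_comm f g)

variable {G : Type*} [Group G] {ρ : G →* End k V}

/-- **Burnside's theorem** in prime dimension, over an arbitrary field: a noncommutative
irreducible group spans the full endomorphism algebra. -/
theorem adjoin_range_eq_top_of_irreducible [FiniteDimensional k V] (hV : (finrank k V).Prime)
    (hirr : ∀ W : Submodule k V, (∀ g, ∀ w ∈ W, ρ g w ∈ W) → W = ⊥ ∨ W = ⊤)
    (hnc : ∃ g h, ρ g * ρ h ≠ ρ h * ρ g) : Algebra.adjoin k (Set.range ρ) = ⊤ := by
  have : Nontrivial V := nontrivial_of_finrank_pos hV.pos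
  set A := Algebra.adjoin k (Set.range ρ) with hA
  have hmem : ∀ g, ρ g ∈ A := fun g => Algebra.subset_adjoin ⟨g, rfl⟩
  have hsimple : IsSimpleModule A V := by
    rw [isSimpleModule_iff]
    refine { exists_pair_ne := ⟨⊥, ⊤, bot_ne_top⟩, eq_bot_or_eq_top := fun W => ?_ }
    refine (hirr (W.restrictScalars k) fun g w hw => W.smul_mem ⟨ρ g, hmem g⟩ hw).imp ?_ ?_ <;>
    · intro h
      ext w
      simpa using SetLike.ext_iff.1 h w
  -- Schur: `d` generates a field. Were it nonscalar, the field would have degree dim V, and its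
  -- centralizer, which contains every `ρ g`, would be commutative.
  have hscal : ∀ d : End k V, (∀ g, d * ρ g = ρ g * d) → d ∈ (⊥ : Subalgebra k (End k V)) := by
    intro d hd
    have hcent : ∀ f ∈ Algebra.adjoin k {d}, ∀ g, ρ g * f = f * ρ g := by
      intro f hf g
      exact Algebra.commute_of_mem_adjoin_of_forall_mem_commute hf
        (by rintro _ rfl; exact (hd g).symm)
    have hfield : IsField (Algebra.adjoin k {d}) := by
      refine Subalgebra.isField_of_mul_eq_zero _ (fun x hx y hy => ?_) fun x hx y _ hne hxy => ?_
      · exact congrArg Subtype.val (mul_comm' (⟨x, hx⟩ : Algebra.adjoin k {d}) ⟨y, hy⟩)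
      · rcases hirr (LinearMap.ker x) (fun g w hw => by
          rw [LinearMap.mem_ker] at hw ⊢
          rw [← Module.End.mul_apply, ← hcent x hx g, Module.End.mul_apply, hw, map_zero]) with h | h
        · ext w
          have : y w ∈ LinearMap.ker x := LinearMap.congr_fun hxy w
          rw [h] at this
          simpa using this
        · exact absurd (LinearMap.ker_eq_top.1 h) hne
    by_contra hnot
    have hne : Algebra.adjoin k {d} ≠ ⊥ := fun h => hnot (h ▸ Algebra.self_mem_adjoin_singleton k d)
    obtain ⟨g, h, hgh⟩ := hnc
    exact hgh (Subalgebra.mul_comm_of_commute_isField hfield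
      (Subalgebra.finrank_eq_of_isField_of_ne_bot hV _ hfield hne)
      (fun f hf => hcent f hf g) fun f hf => hcent f hf h)
  rw [eq_top_iff]
  rintro T -
  -- The commutant of `A` consists of scalars, so every `T` is linear over it; density on a finite
  -- basis puts `T` in `A`.
  let T' : End (End A V) V :=
    { toFun := T
      map_add' := map_add T
      map_smul' := fun d v => by
        obtain ⟨c, hc⟩ := Algebra.mem_bot.1 (hscal (d.restrictScalars k) fun g =>
          LinearMap.ext fun w => d.map_smul ⟨ρ g, hmem g⟩ w)
        have hdc : ∀ w, d w = c • w := fun w => (LinearMap.congr_fun hc w).symm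
        simp [hdc] }
  let b := finBasis k V
  obtain ⟨r, hr⟩ := jacobson_density T' (Set.finite_range b).toFinset
  have : T = r := b.ext fun i => hr (b i) (by simp)
  exact this ▸ r.2

theorem span_range_eq_top_of_irreducible [FiniteDimensional k V] (hV : (finrank k V).Prime)
    (hirr : ∀ W : Submodule k V, (∀ g, ∀ w ∈ W, ρ g w ∈ W) → W = ⊥ ∨ W = ⊤)
    (hnc : ∃ g h, ρ g * ρ h ≠ ρ h * ρ g) : Submodule.span k (Set.range ρ) = ⊤ := by
  have h := congrArg Subalgebra.toSubmodule (adjoin_range_eq_top_of_irreducible hV hirr hnc)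
  rw [Algebra.adjoin_eq_span, ← MonoidHom.coe_mrange, Submonoid.closure_eq] at h
  exact h

/-! ### Abelian normal subgroups of primitive groups -/

/-- The action by conjugation on a normalized subalgebra. -/
def conjAlgHom (ρ : G →* End k V) (E : Subalgebra k (End k V))
    (hE : ∀ g, ∀ a ∈ E, ρ g * a * ρ g⁻¹ ∈ E) : G →* (E →ₐ[k] E) where
  toFun g := AlgHom.ofLinearMap
    { toFun := fun a => ⟨ρ g * a * ρ g⁻¹, hE g a a.2⟩
      map_add' := fun a b => Subtype.ext (by simp [mul_add, add_mul])
      map_smul' := fun c a => Subtype.ext (by simp) }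
    (Subtype.ext (by simp [← map_mul]))
    fun a b => Subtype.ext (by
      change ρ g * (a * b) * ρ g⁻¹ = (ρ g * a * ρ g⁻¹) * (ρ g * b * ρ g⁻¹)
      have : ρ g⁻¹ * ρ g = 1 := by simp [← map_mul]
      simp only [mul_assoc]
      rw [← mul_assoc (ρ g⁻¹) (ρ g), this, one_mul])
  map_one' := AlgHom.ext fun a => Subtype.ext (by simp)
  map_mul' g h := AlgHom.ext fun a => Subtype.ext (by
    change ρ (g * h) * a * ρ (g * h)⁻¹ = ρ g * (ρ h * a * ρ h⁻¹) * ρ g⁻¹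
    simp [mul_assoc])

theorem coe_conjAlgHom {E : Subalgebra k (End k V)} (hE : ∀ g, ∀ a ∈ E, ρ g * a * ρ g⁻¹ ∈ E)
    (g : G) (a : E) : (conjAlgHom ρ E hE g a : End k V) = ρ g * a * ρ g⁻¹ := rfl

/-- Distinct maximal ideals are coprime. Scalars are restricted to `k` because blocks of
imprimitivity are `k`-subspaces. -/
theorem iSupIndep_torsionBySet_maximalSpectrum (k : Type*) {R M : Type*} [Semiring k]
    [CommRing R] [IsArtinianRing R] [AddCommGroup M] [Module R M] [Module k M] [SMul k R]
    [IsScalarTower k R M] :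
    iSupIndep fun m : MaximalSpectrum R =>
      (Submodule.torsionBySet R M (m.asIdeal : Set R)).restrictScalars k := by
  have := Fintype.ofFinite (MaximalSpectrum R)
  have h : iSupIndep fun m : MaximalSpectrum R =>
      Submodule.torsionBySet R M (m.asIdeal : Set R) := by
    rw [iSupIndep_iff_supIndep_univ]
    exact Submodule.supIndep_torsionBySet_ideal fun i _ j _ hij =>
      i.isMaximal.coprime_of_ne j.isMaximal fun h => hij (MaximalSpectrum.ext h)
  intro i
  have hi := disjoint_iff.1 (h i)
  rw [disjoint_iff, ← Submodule.restrictScalars_bot k R M, ← hi]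
  ext v
  simp only [Submodule.mem_inf, Submodule.restrictScalars_mem, ← Submodule.restrictScalars_iSup]

/-- An associated prime annihilates a nonzero vector, and primes of an Artinian ring are maximal. -/
theorem exists_torsionBySet_maximalSpectrum_ne_bot (R M : Type*) [CommRing R] [IsArtinianRing R]
    [AddCommGroup M] [Module R M] [Nontrivial M] :
    ∃ m : MaximalSpectrum R, Submodule.torsionBySet R M (m.asIdeal : Set R) ≠ ⊥ := by
  obtain ⟨P, hP⟩ := associatedPrimes.nonempty R M
  obtain ⟨hprime, x, hx⟩ := isAssociatedPrime_iff.1 hP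
  refine ⟨⟨P, IsArtinianRing.isMaximal_of_isPrime P⟩, fun h => ?_⟩
  have hxT : x ∈ Submodule.torsionBySet R M (P : Set R) := by
    rw [Submodule.mem_torsionBySet_iff]
    rintro ⟨a, ha⟩
    rwa [SetLike.mem_coe, hx, Submodule.mem_colon_singleton] at ha
  rw [h, Submodule.mem_bot] at hxT
  subst hxT
  exact hprime.ne_top (by simp [hx])

open scoped IsMulCommutative in
/-- A commutative subalgebra normalized by a primitive group is a field. -/
theorem Subalgebra.isField_of_primitive [FiniteDimensional k V] [Nontrivial V]
    (hirr : ∀ W : Submodule k V, (∀ g, ∀ w ∈ W, ρ g w ∈ W) → W = ⊥ ∨ W = ⊤)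
    (hprim : ∀ (ι : Type u) [Finite ι] (W : ι → Submodule k V), iSupIndep W → (∀ i, W i ≠ ⊥) →
      iSup W = ⊤ → (∀ g i, ∃ j, (W i).map (ρ g) = W j) → Subsingleton ι)
    (E : Subalgebra k (End k V)) [IsMulCommutative E]
    (hE : ∀ g, ∀ a ∈ E, ρ g * a * ρ g⁻¹ ∈ E) : IsField E := by
  have hartin : IsArtinianRing E := .of_finite k E
  -- The nonzero `T m` will form a system of blocks: conjugation by `G` permutes the maximal ideals
  -- of `E`, hence the `T m`.
  let T : MaximalSpectrum E → Submodule k V := fun m =>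
    (Submodule.torsionBySet E V (m.asIdeal : Set E)).restrictScalars k
  have hT : ∀ m v, v ∈ T m ↔ ∀ a ∈ m.asIdeal, (a : End k V) v = 0 := by
    intro m v
    rw [Submodule.restrictScalars_mem, Submodule.mem_torsionBySet_iff, Subtype.forall]
    rfl
  have hindep : iSupIndep T := iSupIndep_torsionBySet_maximalSpectrum k
  obtain ⟨m₀, hm₀⟩ : ∃ m, T m ≠ ⊥ :=
    (exists_torsionBySet_maximalSpectrum_ne_bot E V).imp fun m h h' =>
      h (Submodule.restrictScalars_injective k E V
        (h'.trans (Submodule.restrictScalars_bot k E V).symm))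
  clear_value T
  have hinv : ∀ g v, ρ g (ρ g⁻¹ v) = v := fun g v => by
    rw [← Module.End.mul_apply, ← map_mul, mul_inv_cancel, map_one, Module.End.one_apply]
  have hperm : ∀ g m, ∃ m', (T m).map (ρ g) = T m' := by
    intro g m
    have hsurj : Function.Surjective (conjAlgHom ρ E hE g⁻¹) := fun a =>
      ⟨conjAlgHom ρ E hE g a, by
        change (conjAlgHom ρ E hE g⁻¹ * conjAlgHom ρ E hE g) a = a
        rw [← map_mul, inv_mul_cancel, map_one]
        rfl⟩
    have := m.isMaximal
    refine ⟨⟨m.asIdeal.comap (conjAlgHom ρ E hE g⁻¹),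
      Ideal.comap_isMaximal_of_surjective _ hsurj⟩, ?_⟩
    ext w
    rw [Submodule.mem_map, hT]
    have hconj : ∀ (a : E) v, (conjAlgHom ρ E hE g⁻¹ a : End k V) v = ρ g⁻¹ (a.1 (ρ g v)) := by
      intro a v
      rw [coe_conjAlgHom, inv_inv]
      rfl
    constructor
    · rintro ⟨v, hv, rfl⟩ a ha
      have := (hT _ v).1 hv _ (Ideal.mem_comap.1 ha)
      rw [hconj] at this
      rw [← hinv g ((a : End k V) (ρ g v)), this, map_zero]
    · intro hw
      refine ⟨ρ g⁻¹ w, (hT _ _).2 fun b hb => ?_, hinv g w⟩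
      obtain ⟨a, rfl⟩ := hsurj b
      rw [hconj, hinv, hw a hb, map_zero]
  let ι := {m : MaximalSpectrum E // T m ≠ ⊥}
  let W : ι → Submodule k V := fun m => T m.1
  have hpermW : ∀ g i, ∃ j, (W i).map (ρ g) = W j := by
    intro g i
    obtain ⟨m, hm⟩ := hperm g i.1
    refine ⟨⟨m, fun h => i.2 ?_⟩, hm⟩
    rw [eq_bot_iff]
    intro v hv
    have hv' : ρ g v ∈ (⊥ : Submodule k V) := h ▸ hm ▸ Submodule.mem_map_of_mem hv
    rw [Submodule.mem_bot] at hv' ⊢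
    rw [← hinv g⁻¹ v, inv_inv, hv', map_zero]
  have htop : iSup W = ⊤ := by
    refine (hirr (iSup W) fun g w hw => ?_).resolve_left fun h => ?_
    · have : (iSup W).map (ρ g) ≤ iSup W := by
        rw [Submodule.map_iSup]
        refine iSup_le fun i => ?_
        obtain ⟨j, hj⟩ := hpermW g i
        exact hj ▸ le_iSup W j
      exact this (Submodule.mem_map_of_mem hw)
    · exact hm₀ (eq_bot_iff.2 (h ▸ le_iSup W ⟨m₀, hm₀⟩))
  have hsub := hprim ι W (hindep.comp Subtype.val_injective) (fun i => i.2) htop hpermW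
  -- By primitivity there is one block; `m₀` then kills all of `V`, so it is zero since `E` acts
  -- faithfully.
  have hi : T m₀ = ⊤ := by
    rw [eq_top_iff, ← htop]
    exact iSup_le fun j => (congrArg W (Subsingleton.elim j ⟨m₀, hm₀⟩)).le
  rw [Ring.isField_iff_maximal_bot]
  have hbot : m₀.asIdeal = ⊥ := by
    rw [eq_bot_iff]
    intro a ha
    refine Subtype.ext (LinearMap.ext fun v => ?_)
    exact (hT m₀ v).1 (hi ▸ Submodule.mem_top) a ha
  exact hbot ▸ m₀.isMaximal

theorem IsSolvable.of_nat_card_eq_prime_or_one {G : Type*} [Group G]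
    (h : Nat.card G = 1 ∨ (Nat.card G).Prime) : Group.IsSolvable G := by
  rcases h with h | h
  · have := (Nat.card_eq_one_iff_unique.1 h).1
    infer_instance
  · have : Fact (Nat.card G).Prime := ⟨h⟩
    have := isCyclic_of_prime_card (α := G) rfl
    exact Group.isSolvable_of_comm fun a b => IsCyclic.commGroup.mul_comm a b

/-- By Artin, the order of the group is the degree over its fixed field, so it divides a prime. -/
theorem isSolvable_algEquiv_of_finrank_prime {K L : Type*} [Field K] [Field L] [Algebra K L]
    (h : (Module.finrank K L).Prime) : Group.IsSolvable (L ≃ₐ[K] L) := by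
  have : FiniteDimensional K L := .of_finrank_pos h.pos
  apply IsSolvable.of_nat_card_eq_prime_or_one
  have hdvd : Nat.card (L ≃ₐ[K] L) ∣ Module.finrank K L := by
    rw [← Subgroup.card_top, ← IntermediateField.finrank_fixedField_eq_card]
    exact ⟨_, (Module.finrank_mul_finrank K _ L).symm.trans (mul_comm _ _)⟩
  rcases h.eq_one_or_self_of_dvd _ hdvd with h' | h'
  · exact .inl h'
  · exact .inr (h' ▸ h)

/-- A primitive group of prime degree with a nonscalar abelian normal subgroup is solvable. -/
theorem isSolvable_of_primitive_of_abelian_normal [FiniteDimensional k V]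
    (hV : (finrank k V).Prime) (hρ : Function.Injective ρ)
    (hirr : ∀ W : Submodule k V, (∀ g, ∀ w ∈ W, ρ g w ∈ W) → W = ⊥ ∨ W = ⊤)
    (hprim : ∀ (ι : Type u) [Finite ι] (W : ι → Submodule k V), iSupIndep W → (∀ i, W i ≠ ⊥) →
      iSup W = ⊤ → (∀ g i, ∃ j, (W i).map (ρ g) = W j) → Subsingleton ι)
    (K : Subgroup G) [K.Normal] (hK : ∀ a ∈ K, ∀ b ∈ K, a * b = b * a)
    (hscal : ∃ a ∈ K, ρ a ∉ (⊥ : Subalgebra k (End k V))) : Group.IsSolvable G := by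
  have : Nontrivial V := nontrivial_of_finrank_pos hV.pos
  set E := Algebra.adjoin k (ρ '' K) with hEdef
  have hmem : ∀ a ∈ K, ρ a ∈ E := fun a ha => Algebra.subset_adjoin ⟨a, ha, rfl⟩
  have hcomm : IsMulCommutative E := by
    refine Algebra.isMulCommutative_adjoin k ?_
    rintro _ ⟨a, ha, rfl⟩ _ ⟨b, hb, rfl⟩
    rw [← map_mul, ← map_mul, hK a ha b hb]
  have hinv : ∀ g, ρ g⁻¹ * ρ g = 1 := fun g => by rw [← map_mul, inv_mul_cancel, map_one]
  have hE : ∀ g, ∀ a ∈ E, ρ g * a * ρ g⁻¹ ∈ E := by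
    intro g a ha
    induction ha using Algebra.adjoin_induction with
    | mem x hx =>
      obtain ⟨y, hy, rfl⟩ := hx
      rw [← map_mul, ← map_mul]
      exact hmem _ (Subgroup.Normal.conj_mem ‹_› y hy g)
    | algebraMap r =>
      rw [← Algebra.commutes, mul_assoc, ← map_mul, mul_inv_cancel, map_one, mul_one]
      exact E.algebraMap_mem r
    | add x y _ _ hx hy => simpa only [mul_add, add_mul] using E.add_mem hx hy
    | mul x y _ _ hx hy =>
      have : ρ g * (x * y) * ρ g⁻¹ = (ρ g * x * ρ g⁻¹) * (ρ g * y * ρ g⁻¹) := by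
        simp only [mul_assoc]
        rw [← mul_assoc (ρ g⁻¹) (ρ g), hinv, one_mul]
      exact this ▸ E.mul_mem hx hy
  have hfield := E.isField_of_primitive hirr hprim hE
  have hne : E ≠ ⊥ := by
    obtain ⟨a, ha, hna⟩ := hscal
    exact fun h => hna (h ▸ hmem a ha)
  have hdim := E.finrank_eq_of_isField_of_ne_bot hV hfield hne
  -- The kernel of `f` centralizes `E`, a subfield of full degree, so it is abelian; the target is
  -- solvable.
  let f : G →* (E ≃ₐ[k] E) :=
    (AlgEquiv.algHomUnitsEquiv k E).toMonoidHom.comp (conjAlgHom ρ E hE).toHomUnits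
  have hker : ∀ g ∈ f.ker, ∀ a ∈ E, ρ g * a = a * ρ g := by
    intro g hg a ha
    have h1 : conjAlgHom ρ E hE g ⟨a, ha⟩ = ⟨a, ha⟩ :=
      AlgEquiv.congr_fun (MonoidHom.mem_ker.1 hg) ⟨a, ha⟩
    have h2 : ρ g * a * ρ g⁻¹ = a := congrArg Subtype.val h1
    nth_rw 2 [← h2]
    rw [mul_assoc, hinv, mul_one]
  have hsolv : Group.IsSolvable (E ≃ₐ[k] E) := by
    let := hfield.toField
    exact isSolvable_algEquiv_of_finrank_prime (K := k) (L := E) (hdim ▸ hV)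
  have hsolv' : Group.IsSolvable f.ker := Group.isSolvable_of_comm fun a b =>
    Subtype.ext (hρ (by
      simpa using Subalgebra.mul_comm_of_commute_isField hfield hdim (hker a a.2) (hker b b.2)))
  exact Group.isSolvable_of_ker_le_range f.ker.subtype f (by simp)

end EndomorphismAlgebra

/-! ### Integral groups and irreducibility modulo almost all primes -/

section IntegralLinearGroup

open Module

variable {n : ℕ}

theorem Matrix.map_intCast_zsmul {R : Type*} [Ring R] (a : ℤ) (A : Matrix (Fin n) (Fin n) ℤ) :
    (a • A).map (Int.cast : ℤ → R) = (a : R) • A.map Int.cast := by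
  ext i j
  rw [Matrix.map_apply, Matrix.smul_apply, Matrix.smul_apply, Matrix.map_apply, smul_eq_mul,
    Int.cast_mul, smul_eq_mul]

theorem Matrix.map_intCast_add {R : Type*} [Ring R] (A B : Matrix (Fin n) (Fin n) ℤ) :
    (A + B).map (Int.cast : ℤ → R) = A.map Int.cast + B.map Int.cast :=
  Matrix.map_add _ (fun a b => Int.cast_add a b) A B

/-- The action of `SL(n, ℤ)` on `F ^ n` by entrywise reduction. -/
noncomputable def slRep (n : ℕ) (F : Type*) [Field F] :
    SpecialLinearGroup (Fin n) ℤ →* End F (Fin n → F) :=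
  ((Matrix.toLinAlgEquiv' : Matrix (Fin n) (Fin n) F ≃ₐ[F] ((Fin n → F) →ₗ[F] (Fin n → F)))
      : Matrix (Fin n) (Fin n) F →* ((Fin n → F) →ₗ[F] (Fin n → F))).comp
    ((Units.coeHom (Matrix (Fin n) (Fin n) F)).comp (slToGL n F))

variable {F : Type*} [Field F] {H : Subgroup (SpecialLinearGroup (Fin n) ℤ)}

theorem slRep_apply (g : SpecialLinearGroup (Fin n) ℤ) :
    slRep n F g = Matrix.toLin' ((g : Matrix (Fin n) (Fin n) ℤ).map Int.cast) := rfl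

theorem slRep_injective : Function.Injective (slRep n ℚ) := by
  intro a b h
  rw [slRep_apply, slRep_apply] at h
  have h' := Matrix.toLin'.injective h
  exact Matrix.SpecialLinearGroup.ext _ _ fun i j =>
    Int.cast_injective (congrFun (congrFun h' i) j)

theorem isIrreducible_naturalRep_map_iff [Nontrivial (Fin n → F)] :
    (naturalRep (H.map (slToGL n F))).IsIrreducible ↔
      ∀ W : Submodule F (Fin n → F), (∀ g : H, ∀ w ∈ W, slRep n F g w ∈ W) → W = ⊥ ∨ W = ⊤ := by
  constructor
  · intro h W hW
    let S : Subrepresentation (naturalRep (H.map (slToGL n F))) :=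
      ⟨W, by rintro ⟨_, g, hg, rfl⟩ v hv; exact hW ⟨g, hg⟩ v hv⟩
    exact (h.eq_bot_or_eq_top S).imp (congrArg Subrepresentation.toSubmodule)
      (congrArg Subrepresentation.toSubmodule)
  · intro h
    refine { exists_pair_ne := ⟨⊥, ⊤, fun e => ?_⟩, eq_bot_or_eq_top := fun S => ?_ }
    · exact bot_ne_top (congrArg Subrepresentation.toSubmodule e)
    · exact (h S.toSubmodule fun g w hw =>
        S.apply_mem_toSubmodule ⟨slToGL n F g, g, g.2, rfl⟩ hw).imp
        (fun e => Subrepresentation.toSubmodule_injective e)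
        (fun e => Subrepresentation.toSubmodule_injective e)

theorem subsingleton_of_not_isSystemOfImprimitivity
    (h : ¬ ∃ (k : ℕ) (V : Fin k → Submodule F (Fin n → F)),
      IsSystemOfImprimitivity (H.map (slToGL n F)) V)
    (ι : Type*) [Finite ι] (W : ι → Submodule F (Fin n → F)) (hind : iSupIndep W)
    (hne : ∀ i, W i ≠ ⊥) (htop : iSup W = ⊤)
    (hperm : ∀ (g : H) i, ∃ j, (W i).map (slRep n F g) = W j) : Subsingleton ι := by
  by_contra hns
  have := not_subsingleton_iff_nontrivial.1 hns
  let e := (Finite.equivFin ι).symm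
  refine h ⟨Nat.card ι, W ∘ e, Finite.one_lt_card, fun i => hne _, ?_, ?_⟩
  · rw [DirectSum.isInternal_submodule_iff_iSupIndep_and_iSup_eq_top]
    exact ⟨hind.comp e.injective, by rw [← htop]; exact e.iSup_comp (g := W)⟩
  · rintro ⟨_, g, hg, rfl⟩ i
    obtain ⟨j, hj⟩ := hperm ⟨g, hg⟩ (e i)
    exact ⟨e.symm j, by simpa using! hj⟩

/-- If `H` spans all rational matrices, its congruence images are irreducible for almost all
primes. -/
theorem exists_finset_irreducible_of_span_eq_top
    (hspan : Submodule.span ℚ (Set.range ((slRep n ℚ).comp H.subtype)) = ⊤) :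
    ∃ S : Finset ℕ, ∀ (p : ℕ) [Fact p.Prime], p ∉ S → ∀ W : Submodule (ZMod p) (Fin n → ZMod p),
      (∀ g : H, ∀ w ∈ W, slRep n (ZMod p) g w ∈ W) → W = ⊥ ∨ W = ⊤ := by
  -- Clearing denominators: a nonzero multiple of `T` is an integral combination of elements of `H`.
  have key : ∀ T ∈ Submodule.span ℚ (Set.range ((slRep n ℚ).comp H.subtype)),
      ∃ (N : ℤ) (A : Matrix (Fin n) (Fin n) ℤ), N ≠ 0 ∧
        A ∈ Submodule.span ℤ (Set.range fun h : H => (h.1 : Matrix (Fin n) (Fin n) ℤ)) ∧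
        (N : ℚ) • T = Matrix.toLin' (A.map Int.cast) := by
    intro T hT
    induction hT using Submodule.span_induction with
    | mem x hx =>
      obtain ⟨h, rfl⟩ := hx
      exact ⟨1, h.1, one_ne_zero, Submodule.subset_span ⟨h, rfl⟩, by simp [slRep_apply]⟩
    | zero => exact ⟨1, 0, one_ne_zero, zero_mem _, by simp⟩
    | add x y _ _ hx hy =>
      obtain ⟨N, A, hN, hA, hx⟩ := hx
      obtain ⟨M, B, hM, hB, hy⟩ := hy
      refine ⟨N * M, M • A + N • B, mul_ne_zero hN hM,
        add_mem (Submodule.smul_mem _ _ hA) (Submodule.smul_mem _ _ hB), ?_⟩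
      rw [Matrix.map_intCast_add, Matrix.map_intCast_zsmul, Matrix.map_intCast_zsmul, map_add, map_smul, map_smul, ← hx, ← hy]
      push_cast
      module
    | smul a x _ hx =>
      obtain ⟨N, A, hN, hA, hx⟩ := hx
      refine ⟨N * a.den, a.num • A, mul_ne_zero hN (by exact_mod_cast a.den_ne_zero),
        Submodule.smul_mem _ _ hA, ?_⟩
      rw [Matrix.map_intCast_zsmul, map_smul, ← hx, smul_smul, smul_smul]
      congr 1
      push_cast
      rw [mul_assoc, mul_comm (a.den : ℚ), Rat.mul_den_eq_num, mul_comm]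
  have hij : ∀ i j : Fin n, ∃ N : ℤ, N ≠ 0 ∧ N • Matrix.single i j (1 : ℤ) ∈
      Submodule.span ℤ (Set.range fun h : H => (h.1 : Matrix (Fin n) (Fin n) ℤ)) := by
    intro i j
    obtain ⟨N, A, hN, hA, h⟩ := key (Matrix.toLin' (Matrix.single i j 1)) (hspan ▸ trivial)
    refine ⟨N, hN, ?_⟩
    convert hA
    rw [← map_smul] at h
    have h' := Matrix.toLin'.injective h
    ext a b
    have h'' := congrFun (congrFun h' a) b
    simp only [Matrix.smul_apply, Matrix.map_apply, Matrix.single_apply, smul_eq_mul] at h'' ⊢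
    split_ifs at h'' ⊢ <;> exact_mod_cast h''
  choose N hN hNmem using hij
  refine ⟨Finset.univ.biUnion fun i => Finset.univ.biUnion fun j => (N i j).natAbs.primeFactors,
    fun p hp hpS W hW => ?_⟩
  -- Modulo such `p` the multipliers are invertible, so `W` is stable under all matrix units.
  have hpN : ∀ i j, ((N i j : ℤ) : ZMod p) ≠ 0 := by
    intro i j h0
    apply hpS
    rw [ZMod.intCast_zmod_eq_zero_iff_dvd, Int.natCast_dvd] at h0
    simp only [Finset.mem_biUnion, Finset.mem_univ, true_and, Nat.mem_primeFactors]
    exact ⟨i, j, hp.out, h0, Int.natAbs_ne_zero.2 (hN i j)⟩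
  have hinv : ∀ A ∈ Submodule.span ℤ (Set.range fun h : H => (h.1 : Matrix (Fin n) (Fin n) ℤ)),
      ∀ w ∈ W, (A.map (Int.cast : ℤ → ZMod p)) *ᵥ w ∈ W := by
    intro A hA w hw
    induction hA using Submodule.span_induction with
    | mem x hx =>
      obtain ⟨h, rfl⟩ := hx
      exact hW h w hw
    | zero => simp
    | add x y _ _ hx hy =>
      rw [Matrix.map_intCast_add, Matrix.add_mulVec]
      exact add_mem hx hy
    | smul a x _ hx =>
      rw [Matrix.map_intCast_zsmul, Matrix.smul_mulVec]
      exact W.smul_mem _ hx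
  have hsingle : ∀ i j, ∀ w ∈ W, Pi.single i (w j) ∈ W := by
    intro i j w hw
    have h := hinv _ (hNmem i j) w hw
    have h2 : (N i j • Matrix.single i j (1 : ℤ)).map (Int.cast : ℤ → ZMod p) =
        (N i j : ZMod p) • Matrix.single i j 1 := by
      ext a b
      simp only [Matrix.smul_apply, Matrix.map_apply, Matrix.single_apply]
      split_ifs <;> simp
    rw [h2, Matrix.smul_mulVec, Submodule.smul_mem_iff _ (hpN i j), Matrix.single_mulVec] at h
    simpa [Function.update_eq_iff] using! h
  by_cases hbot : W = ⊥
  · exact .inl hbot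
  right
  obtain ⟨w, hw, hw0⟩ := (Submodule.ne_bot_iff W).1 hbot
  obtain ⟨j, hj⟩ := Function.ne_iff.1 hw0
  rw [eq_top_iff]
  intro v _
  rw [← Finset.univ_sum_single v]
  refine sum_mem fun i _ => ?_
  have := W.smul_mem (v i / w j) (hsingle i j w hw)
  rwa [← Pi.single_smul, smul_eq_mul, div_mul_cancel₀ _ hj] at this

end IntegralLinearGroup

/-! ### Systems of imprimitivity in prime degree -/

section Imprimitive

open Module

variable {n : ℕ} {F : Type*} [Field F]

theorem naturalRep_injective {G : Subgroup (GL (Fin n) F)} (g : G) :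
    Function.Injective (naturalRep G g) :=
  Function.LeftInverse.injective (g := naturalRep G g⁻¹) fun v => by
    rw [← Module.End.mul_apply, ← map_mul, inv_mul_cancel, map_one, Module.End.one_apply]

/-- An irreducible group permutes the blocks of a system of imprimitivity transitively. -/
theorem IsSystemOfImprimitivity.exists_map_eq {G : Subgroup (GL (Fin n) F)}
    (hirr : (naturalRep G).IsIrreducible) {k : ℕ} {V : Fin k → Submodule F (Fin n → F)}
    (hV : IsSystemOfImprimitivity G V) (i j : Fin k) :
    ∃ g : G, (V i).map (naturalRep G g) = V j := by
  by_contra hj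
  have hind := hV.isInternal.submodule_iSupIndep
  let W : Submodule F (Fin n → F) := ⨆ g : G, (V i).map (naturalRep G g)
  let S : Subrepresentation (naturalRep G) := ⟨W, fun g v hv => by
    have : W.map (naturalRep G g) ≤ W := by
      rw [Submodule.map_iSup]
      refine iSup_le fun h => ?_
      rw [← Submodule.map_comp]
      have hm : (naturalRep G g) ∘ₗ (naturalRep G h) = naturalRep G (g * h) := (map_mul _ _ _).symm
      rw [hm]
      exact le_iSup (fun x : G => (V i).map (naturalRep G x)) (g * h)
    exact this (Submodule.mem_map_of_mem hv)⟩
  have hle : V i ≤ W := by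
    have := le_iSup (fun x : G => (V i).map (naturalRep G x)) 1
    rwa [map_one, Module.End.one_eq_id, Submodule.map_id] at this
  rcases hirr.eq_bot_or_eq_top S with h | h
  · have hW : W = ⊥ := congrArg Subrepresentation.toSubmodule h
    exact hV.ne_bot i (eq_bot_iff.2 (hW ▸ hle))
  · have hW : W = ⊤ := congrArg Subrepresentation.toSubmodule h
    -- The orbit of `V i` would span everything while avoiding `V j`, against independence.
    have hsup : W ≤ ⨆ (l) (_ : l ≠ j), V l := by
      refine iSup_le fun g => ?_
      obtain ⟨l, hl⟩ := hV.permuted g i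
      rw [hl]
      exact le_iSup₂_of_le l (fun e => hj ⟨g, e ▸ hl⟩) le_rfl
    rw [hW, top_le_iff] at hsup
    have := hind j
    rw [hsup, disjoint_top] at this
    exact hV.ne_bot j this

theorem IsSystemOfImprimitivity.finrank_eq_one {G : Subgroup (GL (Fin n) F)} (hn : n.Prime)
    (hirr : (naturalRep G).IsIrreducible) {k : ℕ} {V : Fin k → Submodule F (Fin n → F)}
    (hV : IsSystemOfImprimitivity G V) : k = n ∧ ∀ i, finrank F (V i) = 1 := by
  have hk := hV.two_le
  let i₀ : Fin k := ⟨0, by omega⟩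
  have hdim : ∀ i, finrank F (V i) = finrank F (V i₀) := by
    intro i
    obtain ⟨g, hg⟩ := hV.exists_map_eq hirr i₀ i
    rw [← hg]
    exact (Submodule.equivMapOfInjective _ (naturalRep_injective g) (V i₀)).finrank_eq.symm
  have hsum : k * finrank F (V i₀) = n := by
    have h := (LinearEquiv.ofBijective (DirectSum.coeLinearMap V) hV.isInternal).finrank_eq
    rw [Module.finrank_directSum, Module.finrank_fin_fun] at h
    simpa [hdim] using h
  have hk1 : k = n := (hn.eq_one_or_self_of_dvd k ⟨_, hsum.symm⟩).resolve_left (by omega)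
  refine ⟨hk1, fun i => ?_⟩
  rw [hdim i]
  exact Nat.eq_of_mul_eq_mul_left (by omega : 0 < k) (by rw [hsum, hk1, mul_one])

theorem isMonomialMatrix_of_perm {c : Fin n → F} (hc : ∀ j, c j ≠ 0) {σ : Fin n → Fin n}
    (hσ : Function.Injective σ) :
    IsMonomialMatrix (Matrix.of fun i j => if i = σ j then c j else 0) := by
  have h : ∀ i j, (Matrix.of fun i j => if i = σ j then c j else 0) i j ≠ 0 ↔ i = σ j := by
    intro i j
    simp [hc]
  constructor
  · intro i
    obtain ⟨j, rfl⟩ := Finite.surjective_of_injective hσ i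
    exact ⟨j, (h _ _).2 rfl, fun l hl => hσ ((h _ _).1 hl).symm⟩
  · exact fun j => ⟨σ j, (h _ _).2 rfl, fun l hl => (h _ _).1 hl⟩

/-- An irreducible imprimitive linear group of prime degree is monomial. -/
theorem IsSystemOfImprimitivity.isMonomialLinearGroup {G : Subgroup (GL (Fin n) F)} (hn : n.Prime)
    (hirr : (naturalRep G).IsIrreducible) {k : ℕ} {V : Fin k → Submodule F (Fin n → F)}
    (hV : IsSystemOfImprimitivity G V) : IsMonomialLinearGroup G := by
  obtain ⟨rfl, h1⟩ := hV.finrank_eq_one hn hirr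
  have hind := hV.isInternal.submodule_iSupIndep
  have hgen : ∀ i, ∃ v ∈ V i, v ≠ 0 ∧ ∀ w ∈ V i, ∃ c : F, c • v = w := by
    intro i
    obtain ⟨v, hv, hspan⟩ := finrank_eq_one_iff'.1 (h1 i)
    refine ⟨v, v.2, fun h => hv (Subtype.ext h), fun w hw => ?_⟩
    obtain ⟨c, hc⟩ := hspan ⟨w, hw⟩
    exact ⟨c, congrArg Subtype.val hc⟩
  choose v hvV hv0 hvspan using hgen
  have hli : LinearIndependent F v := hind.linearIndependent V hvV hv0
  -- The columns of `X` are generators of the one-dimensional blocks.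
  let X : Matrix (Fin k) (Fin k) F := (Matrix.of v)ᵀ
  have hX : IsUnit X := by
    rw [← Matrix.linearIndependent_cols_iff_isUnit]
    exact hli
  obtain ⟨x, hx⟩ := hX
  refine ⟨x, fun g hg => ?_⟩
  choose σ hσ using hV.permuted ⟨g, hg⟩
  have hσinj : Function.Injective σ := by
    intro i j hij
    have : (V i).map (naturalRep G ⟨g, hg⟩) = (V j).map (naturalRep G ⟨g, hg⟩) := by
      rw [hσ, hσ, hij]
    exact hind.injective hV.ne_bot
      (Submodule.map_injective_of_injective (naturalRep_injective ⟨g, hg⟩) this)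
  have hc : ∀ j, ∃ c : F, c • v (σ j) = (g : Matrix (Fin k) (Fin k) F) *ᵥ v j := fun j =>
    hvspan _ _ (hσ j ▸ Submodule.mem_map_of_mem (hvV j))
  choose c hc using hc
  have hc0 : ∀ j, c j ≠ 0 := by
    intro j h0
    refine hv0 j (naturalRep_injective ⟨g, hg⟩ ?_)
    rw [map_zero]
    change (g : Matrix (Fin k) (Fin k) F) *ᵥ v j = 0
    rw [← hc, h0, zero_smul]
  have hgx : (g : Matrix (Fin k) (Fin k) F) * X =
      X * Matrix.of fun i j => if i = σ j then c j else 0 := by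
    ext a j
    have h2 := congrFun (hc j) a
    rw [Matrix.mul_apply, Matrix.mul_apply]
    simp only [Pi.smul_apply, smul_eq_mul] at h2
    simpa [X, mul_comm, Matrix.mulVec, dotProduct] using h2.symm
  have : ((x⁻¹ * g * x : GL (Fin k) F) : Matrix (Fin k) (Fin k) F) =
      Matrix.of fun i j => if i = σ j then c j else 0 := by
    rw [mul_assoc, Units.val_mul, Units.val_mul, hx, hgx, ← hx, ← mul_assoc, Units.inv_mul, one_mul]
  rw [this]
  exact isMonomialMatrix_of_perm hc0 hσinj

end Imprimitive

/-! ### Scalar elements of SL(n, ℤ) -/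

section Scalar

variable {n : ℕ}

/-- Only finitely many elements of `SL(n, ℤ)` act as scalars. -/
theorem finite_slRep_mem_bot (hn : n ≠ 0) :
    {g : SpecialLinearGroup (Fin n) ℤ |
      slRep n ℚ g ∈ (⊥ : Subalgebra ℚ (Module.End ℚ (Fin n → ℚ)))}.Finite := by
  have : NeZero n := ⟨hn⟩
  have hdiag : ∀ g ∈ {g : SpecialLinearGroup (Fin n) ℤ |
      slRep n ℚ g ∈ (⊥ : Subalgebra ℚ (Module.End ℚ (Fin n → ℚ)))},
      (g : Matrix (Fin n) (Fin n) ℤ) = Matrix.diagonal fun _ => g 0 0 := by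
    intro g hg
    obtain ⟨c, hc⟩ := Algebra.mem_bot.1 hg
    have hent : ∀ i j, ((g i j : ℤ) : ℚ) = if i = j then c else 0 := by
      intro i j
      have := congrFun (LinearMap.congr_fun hc (Pi.single j 1)) i
      rw [slRep_apply, Matrix.toLin'_apply, Matrix.mulVec_single_one] at this
      simpa [Module.algebraMap_end_apply, Pi.single_apply, eq_comm] using this.symm
    ext i j
    rw [Matrix.diagonal_apply]
    have h00 := hent 0 0
    rw [if_pos rfl] at h00
    have hij := hent i j
    rw [← h00] at hij
    split_ifs at hij ⊢ <;> exact_mod_cast hij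
  have hunit : ∀ g ∈ {g : SpecialLinearGroup (Fin n) ℤ |
      slRep n ℚ g ∈ (⊥ : Subalgebra ℚ (Module.End ℚ (Fin n → ℚ)))}, IsUnit (g 0 0) := by
    intro g hg
    have hdet := g.2
    rw [hdiag g hg, Matrix.det_diagonal, Finset.prod_const, Finset.card_univ,
      Fintype.card_fin] at hdet
    exact IsUnit.of_pow_eq_one hdet hn
  refine Set.Finite.of_finite_image (f := fun g => g 0 0) ?_ ?_
  · refine (Set.toFinite ({1, -1} : Set ℤ)).subset ?_
    rintro _ ⟨g, hg, rfl⟩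
    exact Int.isUnit_iff.1 (hunit g hg)
  · intro a ha b hb hab
    refine Subtype.ext ?_
    rw [hdiag a ha, hdiag b hb]
    simp only at hab
    rw [hab]

end Scalar

/-! ### Proof of both statements -/

theorem lemma2 (n : ℕ) (H : Subgroup (SpecialLinearGroup (Fin n) ℤ)) :
    (¬ IsSolvableByFinite H →
      ∃ S : Finset ℕ, ∀ (p : ℕ) [Fact p.Prime], p ∉ S →
        ¬ IsMonomialLinearGroup (congruenceImage p H)) ∧
    (n.Prime → Infinite H → ¬ Group.IsSolvable H → IsPrimitiveLinearGroup (overRat H) →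
      ∃ S : Finset ℕ, ∀ (p : ℕ) [Fact p.Prime], p ∉ S →
        IsPrimitiveLinearGroup (congruenceImage p H)) := by
  constructor
  · intro hH
    by_cases hfin : {p : ℕ | ∃ _ : Fact p.Prime,
        IsMonomialLinearGroup (congruenceImage p H)}.Finite
    · exact ⟨hfin.toFinset, fun p hp hpS hmon => hpS (hfin.mem_toFinset.2 ⟨hp, hmon⟩)⟩
    · obtain ⟨K, hK, hKfin, hcomm⟩ := exists_abelian_finiteIndex_of_infinite_monomial hfin
      exact absurd ⟨K, hK, Group.isSolvable_of_comm fun a b =>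
        Subtype.ext (hcomm a a.2 b b.2), hKfin⟩ hH
  · intro hn hinf hsolv hprim
    have : NeZero n := ⟨hn.ne_zero⟩
    have hdim : (Module.finrank ℚ (Fin n → ℚ)).Prime := by rwa [Module.finrank_fin_fun]
    rw [overRat_eq_map] at hprim
    have hirr := isIrreducible_naturalRep_map_iff.1 hprim.1
    have hblocks := subsingleton_of_not_isSystemOfImprimitivity hprim.2
    have hinj : Function.Injective ((slRep n ℚ).comp H.subtype) :=
      slRep_injective.comp Subtype.val_injective
    have hspan := span_range_eq_top_of_irreducible (ρ := (slRep n ℚ).comp H.subtype) hdim hirr (by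
      by_contra! hc
      exact hsolv (Group.isSolvable_of_comm fun a b => hinj (by rw [map_mul, map_mul, hc])))
    obtain ⟨S, hS⟩ := exists_finset_irreducible_of_span_eq_top hspan
    have hfin : {p : ℕ | ∃ _ : Fact p.Prime,
        IsMonomialLinearGroup (congruenceImage p H)}.Finite := by
      by_contra hinfp
      obtain ⟨K, hK, hKfin, hcomm⟩ := exists_abelian_finiteIndex_of_infinite_monomial hinfp
      refine hsolv (isSolvable_of_primitive_of_abelian_normal (ρ := (slRep n ℚ).comp H.subtype)
        hdim hinj hirr (fun ι _ W => hblocks ι W) K hcomm ?_)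
      by_contra! hscal
      -- A scalar `K` would be finite, and then so would `H`, since `K` has finite index.
      have hKf : Finite K := by
        have := (finite_slRep_mem_bot hn.ne_zero).to_subtype
        exact Finite.of_injective
          (fun a : K => (⟨a.1.1, hscal a.1 a.2⟩ : {g : SpecialLinearGroup (Fin n) ℤ |
            slRep n ℚ g ∈ (⊥ : Subalgebra ℚ (Module.End ℚ (Fin n → ℚ)))}))
          fun a b hab => Subtype.ext (Subtype.ext (Subtype.mk.inj hab))
      exact not_finite_iff_infinite.2 hinf ((Subgroup.finite_iff_finite_and_finiteIndex K).2 ⟨hKf, hKfin⟩)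
    refine ⟨S ∪ hfin.toFinset, fun p hp hpS => ?_⟩
    rw [Finset.mem_union, not_or, Set.Finite.mem_toFinset] at hpS
    have hirrp : (naturalRep (congruenceImage p H)).IsIrreducible := by
      rw [congruenceImage_eq_map]
      exact isIrreducible_naturalRep_map_iff.2 (hS p hpS.1)
    exact ⟨hirrp, fun ⟨_, _, hV⟩ => hpS.2 ⟨hp, hV.isMonomialLinearGroup hn hirrp⟩⟩
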